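/- A stochastic game with rewards consists of a finite set $V$ of vertices partitioned into $V_1,V_2,V_{\mathsf P}$ (parts may be empty), a transition function $\delta:V\times V\to[0,1]$ with $\delta(v,\cdot)\in\{0,1\}$ for $v\in V_1\cup V_2$ and $\delta(v,\cdot)$ a probability distribution for $v\in V_{\mathsf P}$, such that $\mathrm{post}(v)=\{v' : \delta(v,v')>0\}\neq\emptyset$ for all $v$, and a reward function $r:V\to[0,\infty)$. A vertex $v$ is terminal if $\delta(v,v)=1$ and $\delta(v,v')=0$ for $v'\ne v$; let $T$ be the set of terminal vertices, and assume $r=0$ on $T$. A path is a sequence $v_0v_1\dots$ with $\delta(v_k,v_{k+1})>0$ for all $k$. A strategy of Player $i$ assigns to each finite sequence $\hat\omega v$ with $\hat\omega\in V^*$, $v\in V_i$, a probability distribution supported in $\mathrm{post}(v)$; it is memoryless if it depends only on $v$. Let $\Pi_i$ and $\Pi_i^{M}$ be the sets of all, respectively all memoryless, strategies of Player $i$. Strategies $\pi_1\in\Pi_1,\pi_2\in\Pi_2$ and an initial vertex $v$ induce a probability measure $\mathbb P^{\pi_1,\pi_2}_v$ on infinite sequences of vertices, with expectation $\mathbb E^{\pi_1,\pi_2}_v$.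 A strategy $\pi_2\in\Pi_2$ is fair if, for all $\pi_1\in\Pi_1$ and $v\in V$, with $\mathbb P^{\pi_1,\pi_2}_v$-probability $1$ the play is a path in which, whenever a vertex $u\in V_2$ occurs infinitely often, every vertex of $\mathrm{post}(u)$ occurs infinitely often. Let $\Pi_2^{F}$ be the set of fair strategies and $\Pi_2^{MF}=\Pi_2^{M}\cap\Pi_2^{F}$. The game is stopping under fairness if for all $\pi_1\in\Pi_1$, $\pi_2\in\Pi_2^{F}$ and $v\in V$ a vertex of $T$ is reached with $\mathbb P^{\pi_1,\pi_2}_v$-probability $1$. Let $\mathrm{rew}(\omega)=\sum_{i=0}^\infty r(\omega_i)\in[0,\infty]$. Theorem. For every stochastic game with rewards that is stopping under fairness and every vertex $v$, \[ \sup_{\pi_1\in\Pi_1}\ \inf_{\pi_2\in\Pi_2^{F}}\ \mathbb E^{\pi_1,\pi_2}_v[\mathrm{rew}] \;=\; \sup_{\pi_1\in\Pi_1^{M}}\ \inf_{\pi_2\in\Pi_2^{MF}}\ \mathbb E^{\pi_1,\pi_2}_v[\mathrm{rew}]. \] -/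

import Mathlib

open MeasureTheory ProbabilityTheory Filter
open scoped ENNReal NNReal

/-- Who resolves the choice at a vertex: one of the two players, or chance. -/
inductive Owner where
  | player1
  | player2
  | chance

/-- A stochastic game on the finite vertex set `V`. The partition `(V₁, V₂, V_P)` is given by
the function `owner`; every part may be empty. -/
structure StochasticGame (V : Type*) [Fintype V] where
  owner : V → Owner
  /-- the probabilistic transition function -/
  δ : V → V → ℝ≥0
  player1_zero_or_one : ∀ v, owner v = Owner.player1 → ∀ w, δ v w = 0 ∨ δ v w = 1
  player2_zero_or_one : ∀ v, owner v = Owner.player2 → ∀ w, δ v w = 0 ∨ δ v w = 1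
  chance_sum : ∀ v, owner v = Owner.chance → ∑ w, δ v w = 1
  post_nonempty : ∀ v, ∃ w, 0 < δ v w

namespace StochasticGame

variable {V : Type*} [Fintype V]

/-- The vertices of Player 1. -/
def V₁ (G : StochasticGame V) : Set V := {v | G.owner v = Owner.player1}

/-- The vertices of Player 2. -/
def V₂ (G : StochasticGame V) : Set V := {v | G.owner v = Owner.player2}

/-- The successors of a vertex. -/
def post (G : StochasticGame V) (v : V) : Set V := {w | 0 < G.δ v w}

/-- The set of terminal vertices. -/
def terminal (G : StochasticGame V) : Set V := {v | G.δ v v = 1 ∧ ∀ w, w ≠ v → G.δ v w = 0}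

/-- A (randomized, history dependent) strategy of the player owning the vertices in `S`: to
every finite sequence `h v` with `h ∈ V*` (listed from the first vertex on) and `v ∈ S` it
assigns a distribution `choice h v` on the successors of `v`. -/
structure Strategy (G : StochasticGame V) (S : Set V) where
  choice : List V → S → PMF V
  choice_post : ∀ (h : List V) (v : S) (w : V), 0 < choice h v w → w ∈ G.post v

/-- The strategy only looks at the current vertex. -/
def Strategy.Memoryless {G : StochasticGame V} {S : Set V} (σ : G.Strategy S) : Prop :=
  ∀ (h : List V) (v : S), σ.choice h v = σ.choice [] v

/-- The distribution `δ(v, ·)` at a chance vertex. -/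
noncomputable def chanceLaw (G : StochasticGame V) (v : V) (hv : G.owner v = Owner.chance) :
    PMF V :=
  PMF.ofFintype (fun w => (G.δ v w : ℝ≥0∞)) (by exact_mod_cast G.chance_sum v hv)

/-- The distribution of the next vertex, when the vertices `h` were visited before and the
play is now in `v`. -/
noncomputable def nextLaw (G : StochasticGame V) (σ₁ : G.Strategy G.V₁) (σ₂ : G.Strategy G.V₂)
    (h : List V) (v : V) : PMF V :=
  match hv : G.owner v with
  | Owner.player1 => σ₁.choice h ⟨v, hv⟩
  | Owner.player2 => σ₂.choice h ⟨v, hv⟩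
  | Owner.chance => G.chanceLaw v hv

/-- The set of all paths of the game. -/
def paths (G : StochasticGame V) : Set (ℕ → V) := {ω | ∀ k, 0 < G.δ (ω k) (ω (k + 1))}

/-- The fair plays for Player 2: if a vertex of Player 2 occurs infinitely often, so does each
of its successors. -/
def fairPlays (G : StochasticGame V) : Set (ℕ → V) :=
  {ω | ω ∈ G.paths ∧ ∀ v ∈ G.V₂, (∃ᶠ n in atTop, ω n = v) →
    ∀ w ∈ G.post v, ∃ᶠ n in atTop, ω n = w}

/-- The paths that reach a terminal vertex. -/
def reachTerminal (G : StochasticGame V) : Set (ℕ → V) :=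
  {ω | ω ∈ G.paths ∧ ∃ i, ω i ∈ G.terminal}

variable [MeasurableSpace V] [MeasurableSingletonClass V]

/-- The transition kernel from the vertices at times `0, …, n` to the vertex at time `n + 1`. -/
noncomputable def stepKernel (G : StochasticGame V) (σ₁ : G.Strategy G.V₁)
    (σ₂ : G.Strategy G.V₂) (n : ℕ) : Kernel ((i : Finset.Iic n) → V) V :=
  Kernel.ofFunOfCountable fun x =>
    (G.nextLaw σ₁ σ₂
      (List.ofFn fun i : Fin n => x ⟨i, Finset.mem_Iic.2 i.isLt.le⟩)
      (x ⟨n, Finset.mem_Iic.2 le_rfl⟩)).toMeasure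

instance (G : StochasticGame V) (σ₁ : G.Strategy G.V₁) (σ₂ : G.Strategy G.V₂) (n : ℕ) :
    IsMarkovKernel (G.stepKernel σ₁ σ₂ n) :=
  ⟨fun _ => PMF.toMeasure.isProbabilityMeasure _⟩

/-- The probability measure on infinite sequences of vertices that the two strategies induce
from the initial vertex `v` (Ionescu-Tulcea). -/
noncomputable def pathMeasure (G : StochasticGame V) (σ₁ : G.Strategy G.V₁)
    (σ₂ : G.Strategy G.V₂) (v : V) : Measure (ℕ → V) :=
  Kernel.traj (X := fun _ => V) (G.stepKernel σ₁ σ₂) 0 (fun _ => v)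

/-- A strategy of Player 2 is (almost surely) fair if it produces a fair play with probability
one, against every strategy of Player 1 and from every vertex. -/
def Fair (G : StochasticGame V) (σ₂ : G.Strategy G.V₂) : Prop :=
  ∀ (σ₁ : G.Strategy G.V₁) (v : V), G.pathMeasure σ₁ σ₂ v G.fairPlays = 1

/-- The game reaches a terminal vertex almost surely whenever Player 2 is fair. -/
def StoppingUnderFairness (G : StochasticGame V) : Prop :=
  ∀ (σ₁ : G.Strategy G.V₁) (σ₂ : G.Strategy G.V₂), G.Fair σ₂ →
    ∀ v : V, G.pathMeasure σ₁ σ₂ v G.reachTerminal = 1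

end StochasticGame

/-- A stochastic game with nonnegative rewards, which vanish at terminal vertices. -/
structure RewardGame (V : Type*) [Fintype V] extends StochasticGame V where
  reward : V → ℝ≥0
  reward_terminal : ∀ v ∈ toStochasticGame.terminal, reward v = 0

namespace RewardGame

variable {V : Type*} [Fintype V]

/-- The total accumulated reward of a play. -/
noncomputable def totalReward (G : RewardGame V) (ω : ℕ → V) : ℝ≥0∞ :=
  ∑' i, (G.reward (ω i) : ℝ≥0∞)

variable [MeasurableSpace V] [MeasurableSingletonClass V]

/-- The expected total accumulated reward from the initial vertex `v`. -/
noncomputable def expectedReward (G : RewardGame V) (σ₁ : G.Strategy G.V₁)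
    (σ₂ : G.Strategy G.V₂) (v : V) : ℝ≥0∞ :=
  ∫⁻ ω, G.totalReward ω ∂(G.pathMeasure σ₁ σ₂ v)

end RewardGame

namespace StochasticGame

/-! ### Transition law, Markov property and recurrence -/

variable {V : Type*} [Fintype V]

lemma mem_post_of_nextLaw_ne_zero (G : StochasticGame V) (σ₁ : G.Strategy G.V₁)
    (σ₂ : G.Strategy G.V₂) (h : List V) (v w : V) (hw : G.nextLaw σ₁ σ₂ h v w ≠ 0) :
    w ∈ G.post v := by
  unfold nextLaw at hw
  split at hw
  · exact σ₁.choice_post _ _ _ (pos_iff_ne_zero.2 hw)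
  · exact σ₂.choice_post _ _ _ (pos_iff_ne_zero.2 hw)
  · simpa [chanceLaw, post, pos_iff_ne_zero] using hw

lemma nextLaw_player1 (G : StochasticGame V) (σ₁ : G.Strategy G.V₁) (σ₂ : G.Strategy G.V₂)
    (h : List V) {v : V} (hv : v ∈ G.V₁) : G.nextLaw σ₁ σ₂ h v = σ₁.choice h ⟨v, hv⟩ := by
  have hv' : G.owner v = Owner.player1 := hv
  unfold nextLaw
  split <;> first | rfl | simp_all

lemma nextLaw_player2 (G : StochasticGame V) (σ₁ : G.Strategy G.V₁) (σ₂ : G.Strategy G.V₂)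
    (h : List V) {v : V} (hv : v ∈ G.V₂) : G.nextLaw σ₁ σ₂ h v = σ₂.choice h ⟨v, hv⟩ := by
  have hv' : G.owner v = Owner.player2 := hv
  unfold nextLaw
  split <;> first | rfl | simp_all

lemma nextLaw_chance (G : StochasticGame V) (σ₁ : G.Strategy G.V₁) (σ₂ : G.Strategy G.V₂)
    (h : List V) {v : V} (hv : G.owner v = Owner.chance) (w : V) :
    G.nextLaw σ₁ σ₂ h v w = G.δ v w := by
  unfold nextLaw
  split
  · simp_all
  · simp_all
  · simp [chanceLaw]

lemma eq_of_mem_terminal_of_mem_post (G : StochasticGame V) {v w : V} (hv : v ∈ G.terminal)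
    (hw : w ∈ G.post v) : w = v := by
  by_contra h
  exact absurd (hv.2 w h) (pos_iff_ne_zero.1 hw)

lemma mem_terminal_of_le (G : StochasticGame V) {ω : ℕ → V} (hω : ω ∈ G.paths) {i j : ℕ}
    (hij : i ≤ j) (hi : ω i ∈ G.terminal) : ω j ∈ G.terminal := by
  induction j, hij using Nat.le_induction with
  | base => exact hi
  | succ k _ ih => rwa [G.eq_of_mem_terminal_of_mem_post ih (hω k)]

variable [MeasurableSpace V] [MeasurableSingletonClass V]

instance (G : StochasticGame V) (σ₁ : G.Strategy G.V₁) (σ₂ : G.Strategy G.V₂) (v : V) :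
    IsProbabilityMeasure (G.pathMeasure σ₁ σ₂ v) := by
  unfold pathMeasure; infer_instance

/-- `Y` factors through the coordinates up to `n`, which range over a finite space where every
function is measurable. Padding the later coordinates needs a vertex, hence the separate empty case.
-/
lemma measurable_of_dependsOn_le {n : ℕ} {Y : (ℕ → V) → ℝ≥0∞}
    (hY : ∀ ω ω', (∀ i ≤ n, ω i = ω' i) → Y ω = Y ω') : Measurable Y := by
  rcases isEmpty_or_nonempty V with h | ⟨⟨v⟩⟩
  · exact measurable_of_countable _
  · have : Y = (fun x : (i : Finset.Iic n) → V =>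
        Y fun i => if h : i ≤ n then x ⟨i, Finset.mem_Iic.2 h⟩ else v) ∘
          Preorder.frestrictLe (π := fun _ => V) n := by
      ext ω
      exact hY _ _ fun i hi => by simp [hi]
    rw [this]
    exact (measurable_of_countable _).comp (Preorder.measurable_frestrictLe n)

/-- The Markov property: conditionally on the play up to time `n`, the next vertex is distributed
according to `nextLaw`. -/
lemma lintegral_pathMeasure_succ (G : StochasticGame V) (σ₁ : G.Strategy G.V₁)
    (σ₂ : G.Strategy G.V₂) (v : V) (n : ℕ) (F : (ℕ → V) → V → ℝ≥0∞)
    (hF : ∀ ω ω', (∀ i ≤ n, ω i = ω' i) → F ω = F ω') :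
    ∫⁻ ω, F ω (ω (n + 1)) ∂(G.pathMeasure σ₁ σ₂ v) =
      ∫⁻ ω, ∑ w, F ω w * G.nextLaw σ₁ σ₂ (List.ofFn fun i : Fin n => ω i) (ω n) w
        ∂(G.pathMeasure σ₁ σ₂ v) := by
  set κ := G.stepKernel σ₁ σ₂ with hκ
  set x₀ : (i : Finset.Iic 0) → V := fun _ => v
  have hP : G.pathMeasure σ₁ σ₂ v = Kernel.traj (X := fun _ => V) κ 0 x₀ := rfl
  -- `e` continues a history by the constant `v` after time `n`; by `hF` the padding does not
  -- influence `F`.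
  set e : ((i : Finset.Iic n) → V) → ℕ → V := fun x i =>
    if h : i ≤ n then x ⟨i, Finset.mem_Iic.2 h⟩ else v with he
  have hFe : ∀ ω, F ω = F (e (Preorder.frestrictLe (π := fun _ => V) n ω)) := fun ω =>
    hF _ _ fun i hi => by simp [he, hi]
  have hm : Measurable fun p : ((i : Finset.Iic n) → V) × V => F (e p.1) p.2 :=
    measurable_of_countable _
  have hstep : ∀ x : (i : Finset.Iic n) → V,
      ∫⁻ y, F (e x) (y (n + 1)) ∂(Kernel.traj (X := fun _ => V) κ n x) =
        ∑ w, F (e x) w * G.nextLaw σ₁ σ₂ (List.ofFn fun i : Fin n => e x i) (e x n) w := by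
    intro x
    have h1 : (Kernel.traj (X := fun _ => V) κ n x).map (fun y => y (n + 1)) = κ n x := by
      rw [← Kernel.map_apply _ (measurable_pi_apply _), Kernel.map_traj_succ_self]
    rw [← lintegral_map (f := fun w => F (e x) w) (measurable_of_countable _)
      (measurable_pi_apply _), h1, lintegral_fintype]
    refine Finset.sum_congr rfl fun w _ => ?_
    congr 1
    change (G.nextLaw σ₁ σ₂ (List.ofFn fun i : Fin n => x ⟨i, Finset.mem_Iic.2 i.isLt.le⟩)
      (x ⟨n, Finset.mem_Iic.2 le_rfl⟩)).toMeasure {w} = _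
    rw [PMF.toMeasure_apply_singleton _ _ (measurableSet_singleton w)]
    simp [he, le_of_lt]
  have hmap := Kernel.partialTraj_compProd_traj (X := fun _ => V) (κ := κ) (Nat.zero_le n) x₀
  have hL : ∫⁻ ω, F ω (ω (n + 1)) ∂(G.pathMeasure σ₁ σ₂ v) =
      ∫⁻ p, F (e p.1) (p.2 (n + 1)) ∂((Kernel.traj (X := fun _ => V) κ 0 x₀).map
        (fun x => (Preorder.frestrictLe (π := fun _ => V) n x, x))) := by
    rw [lintegral_map, hP]
    · exact lintegral_congr fun ω => by rw [← hFe ω]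
    · exact hm.comp (measurable_fst.prodMk ((measurable_pi_apply _).comp measurable_snd))
    · exact (Preorder.measurable_frestrictLe n).prodMk measurable_id
  rw [hL, ← hmap, Measure.lintegral_compProd]
  · simp_rw [hstep]
    rw [← Kernel.traj_map_frestrictLe_apply, lintegral_map (measurable_of_countable _)
      (Preorder.measurable_frestrictLe n), hP]
    refine lintegral_congr fun ω => ?_
    rw [← hFe ω]
    simp [he, le_of_lt]
  · exact hm.comp (measurable_fst.prodMk ((measurable_pi_apply _).comp measurable_snd))

lemma ae_eq_zero (G : StochasticGame V) (σ₁ : G.Strategy G.V₁) (σ₂ : G.Strategy G.V₂) (v : V) :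
    ∀ᵐ ω ∂(G.pathMeasure σ₁ σ₂ v), ω 0 = v := by
  have h := Kernel.traj_map_frestrictLe_apply (X := fun _ => V) (κ := G.stepKernel σ₁ σ₂) 0 0
    (fun _ => v)
  rw [Kernel.partialTraj_self, Kernel.id_apply] at h
  have h2 : ∀ᵐ x ∂((G.pathMeasure σ₁ σ₂ v).map (Preorder.frestrictLe (π := fun _ => V) 0)),
      x ⟨0, by simp⟩ = v := by
    unfold pathMeasure
    rw [h, ae_dirac_eq]
    exact rfl
  exact ae_of_ae_map (Preorder.measurable_frestrictLe 0).aemeasurable h2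

/-- A property of single steps that the transition law guarantees holds almost surely. -/
lemma ae_step (G : StochasticGame V) (σ₁ : G.Strategy G.V₁) (σ₂ : G.Strategy G.V₂) (v : V)
    (R : V → V → Prop)
    (hR : ∀ h u w, G.nextLaw σ₁ σ₂ h u w ≠ 0 → R u w) :
    ∀ᵐ ω ∂(G.pathMeasure σ₁ σ₂ v), ∀ n, R (ω n) (ω (n + 1)) := by
  classical
  refine ae_all_iff.2 fun n => ?_
  have h := G.lintegral_pathMeasure_succ σ₁ σ₂ v n
    (fun ω w => if R (ω n) w then 0 else 1) (fun ω ω' hω => by simp [hω n le_rfl])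
  have h0 : ∀ ω : ℕ → V, ∑ w, (if R (ω n) w then 0 else 1) *
      G.nextLaw σ₁ σ₂ (List.ofFn fun i : Fin n => ω i) (ω n) w = 0 := by
    intro ω
    refine Finset.sum_eq_zero fun w _ => ?_
    by_cases hw : G.nextLaw σ₁ σ₂ (List.ofFn fun i : Fin n => ω i) (ω n) w = 0
    · simp [hw]
    · simp [hR _ _ _ hw]
  simp only [h0, lintegral_zero] at h
  rw [lintegral_eq_zero_iff] at h
  · filter_upwards [h] with ω hω
    by_contra hc
    simp [hc] at hω
  · refine measurable_of_dependsOn_le (n := n + 1) fun ω ω' hω => ?_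
    rw [hω n (by omega), hω (n + 1) le_rfl]

lemma ae_mem_paths (G : StochasticGame V) (σ₁ : G.Strategy G.V₁) (σ₂ : G.Strategy G.V₂) (v : V) :
    ∀ᵐ ω ∂(G.pathMeasure σ₁ σ₂ v), ω ∈ G.paths :=
  G.ae_step σ₁ σ₂ v (fun u w => w ∈ G.post u) (G.mem_post_of_nextLaw_ne_zero σ₁ σ₂)

lemma measurableSet_reachTerminal (G : StochasticGame V) : MeasurableSet G.reachTerminal := by
  have h : G.reachTerminal = (⋂ k, {ω : ℕ → V | 0 < G.δ (ω k) (ω (k + 1))}) ∩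
      ⋃ i, {ω : ℕ → V | ω i ∈ G.terminal} := by
    ext ω; simp [reachTerminal, paths]
  rw [h]
  refine (MeasurableSet.iInter fun k => ?_).inter (MeasurableSet.iUnion fun i => ?_)
  · have hm : Measurable fun ω : ℕ → V => (ω k, ω (k + 1)) := by fun_prop
    exact hm (Set.to_countable {p : V × V | 0 < G.δ p.1 p.2}).measurableSet
  · exact measurable_pi_apply i (Set.to_countable G.terminal).measurableSet

/-- If the step from `u` to `w` always has probability at least `p > 0`, then `u` cannot be visited
infinitely often without `w` being visited infinitely often. -/
lemma ae_frequently_of_le_nextLaw (G : StochasticGame V) (σ₁ : G.Strategy G.V₁)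
    (σ₂ : G.Strategy G.V₂) (v u w : V) (p : ℝ≥0) (hp : 0 < p)
    (hu : ∀ h, (p : ℝ≥0∞) ≤ G.nextLaw σ₁ σ₂ h u w) :
    ∀ᵐ ω ∂(G.pathMeasure σ₁ σ₂ v), (∃ᶠ n in atTop, ω n = u) → ∃ᶠ n in atTop, ω n = w := by
  classical
  have hp1 : (p : ℝ≥0∞) ≤ 1 := (hu []).trans (PMF.coe_le_one _ _)
  have hp1' : p ≤ 1 := by exact_mod_cast hp1
  -- A betting argument: capital is multiplied by `1 + p` at each step from `u` that misses `w`, and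
  -- is lost on entering `w`. Since `(1 + p)(1 - p) ≤ 1`, the capital is a nonnegative
  -- supermartingale.
  set a : ℝ≥0 := 1 + p with ha
  let c : V → V → ℝ≥0∞ := fun x y =>
    (if x = u then (a : ℝ≥0∞) else 1) * if y = w then 0 else 1
  have hsub : ∀ h x, ∑ y, c x y * G.nextLaw σ₁ σ₂ h x y ≤ 1 := by
    intro h x
    have h1 : ∑ y, G.nextLaw σ₁ σ₂ h x y = 1 := by
      rw [← tsum_fintype (L := .unconditional V)]; exact PMF.tsum_coe _
    by_cases hx : x = u
    · subst hx
      have h2 : ∑ y, (if y = w then 0 else 1) * G.nextLaw σ₁ σ₂ h x y + p ≤ 1 := by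
        calc _ ≤ ∑ y, (if y = w then 0 else 1) * G.nextLaw σ₁ σ₂ h x y +
              G.nextLaw σ₁ σ₂ h x w := by gcongr; exact hu h
          _ = ∑ y, G.nextLaw σ₁ σ₂ h x y := by
              rw [← Finset.sum_erase_add _ _ (Finset.mem_univ w),
                ← Finset.sum_erase_add (a := w) (f := fun y => G.nextLaw σ₁ σ₂ h x y) _
                  (Finset.mem_univ w)]
              simp only [if_true, zero_mul, add_zero]
              congr 1
              refine Finset.sum_congr rfl fun y hy => ?_
              simp [Finset.ne_of_mem_erase hy]
          _ = 1 := h1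
      simp only [c, if_true, mul_assoc, ← Finset.mul_sum]
      have h3 : ∑ y, (if y = w then 0 else 1) * G.nextLaw σ₁ σ₂ h x y ≤ ((1 - p : ℝ≥0) : ℝ≥0∞) := by
        rw [ENNReal.coe_sub, ENNReal.coe_one]
        exact ENNReal.le_sub_of_add_le_right ENNReal.coe_ne_top h2
      calc _ ≤ (a : ℝ≥0∞) * ((1 - p : ℝ≥0) : ℝ≥0∞) := by gcongr
        _ ≤ 1 := by
          rw [← ENNReal.coe_mul, ← ENNReal.coe_one, ENNReal.coe_le_coe, ← NNReal.coe_le_coe]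
          push_cast [NNReal.coe_sub hp1', ha]
          nlinarith [sq_nonneg (p : ℝ)]
    · calc _ ≤ ∑ y, G.nextLaw σ₁ σ₂ h x y := by
            refine Finset.sum_le_sum fun y _ => ?_
            simp only [c, hx, if_false, one_mul]
            split_ifs <;> simp
        _ ≤ 1 := h1.le
  -- Betting starts at time `m`, to be chosen after the last visit to `w`, so that earlier visits do
  -- not ruin the capital.
  let Z : ℕ → ℕ → (ℕ → V) → ℝ≥0∞ := fun m n ω =>
    ∏ k ∈ Finset.range n, if k < m then 1 else c (ω k) (ω (k + 1))
  have hZdep : ∀ m n ω ω', (∀ i ≤ n, ω i = ω' i) → Z m n ω = Z m n ω' := by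
    intro m n ω ω' h
    refine Finset.prod_congr rfl fun k hk => ?_
    have := Finset.mem_range.1 hk
    rw [h k (by omega), h (k + 1) (by omega)]
  have hZ : ∀ m n, ∫⁻ ω, Z m n ω ∂(G.pathMeasure σ₁ σ₂ v) ≤ 1 := by
    intro m n
    induction n with
    | zero => simp [Z]
    | succ n ih =>
      refine le_trans ?_ ih
      have h := G.lintegral_pathMeasure_succ σ₁ σ₂ v n
        (fun ω y => Z m n ω * if n < m then 1 else c (ω n) y)
        (fun ω ω' h => by rw [hZdep m n ω ω' h, h n le_rfl])
      simp only [Z, Finset.prod_range_succ] at h ⊢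
      rw [h]
      refine lintegral_mono fun ω => ?_
      simp only [mul_assoc]
      rw [← Finset.mul_sum]
      refine mul_le_of_le_one_right zero_le ?_
      split_ifs
      · simp only [one_mul]
        rw [← tsum_fintype (L := .unconditional V)]; exact (PMF.tsum_coe _).le
      · exact hsub _ _
  -- Fatou's lemma bounds the expected limit inferior by 1. Infinitely many visits to `u` after the
  -- last visit to `w` would make it infinite.
  have hfin : ∀ m, ∀ᵐ ω ∂(G.pathMeasure σ₁ σ₂ v), liminf (fun n => Z m n ω) atTop < ∞ := by
    intro m
    refine ae_lt_top (Measurable.liminf fun n => measurable_of_dependsOn_le (hZdep m n)) ?_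
    refine ne_top_of_le_ne_top ENNReal.one_ne_top
      ((lintegral_liminf_le fun n => measurable_of_dependsOn_le (hZdep m n)).trans ?_)
    exact liminf_le_of_frequently_le' (Frequently.of_forall (hZ m))
  filter_upwards [ae_all_iff.2 hfin] with ω hω hfu
  by_contra hw
  rw [not_frequently] at hw
  obtain ⟨m, hm⟩ := eventually_atTop.1 hw
  refine absurd (hω m) (not_lt_of_ge (top_le_iff.2 ?_))
  refine Tendsto.liminf_eq ?_
  have hfac : ∀ k, (if k < m then (1 : ℝ≥0∞) else c (ω k) (ω (k + 1))) =
      if k < m then 1 else if ω k = u then (a : ℝ≥0∞) else 1 := by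
    intro k
    split_ifs with h1 h2
    · rfl
    · simp [c, h2, hm (k + 1) (by omega)]
    · simp [c, h2, hm (k + 1) (by omega)]
  have ha1 : (1 : ℝ≥0∞) ≤ a := by
    rw [← ENNReal.coe_one, ENNReal.coe_le_coe, ha]; exact le_self_add
  have hfac1 : ∀ k, 1 ≤ (if k < m then (1 : ℝ≥0∞) else c (ω k) (ω (k + 1))) := by
    intro k
    rw [hfac]
    split_ifs <;> first | exact le_rfl | exact ha1
  have hmono : Monotone fun n => Z m n ω := by
    refine monotone_nat_of_le_succ fun n => ?_
    simp only [Z, Finset.prod_range_succ]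
    exact le_mul_of_one_le_right zero_le (hfac1 n)
  have hgrow : ∀ j : ℕ, ∃ n, (a : ℝ≥0∞) ^ j ≤ Z m n ω := by
    intro j
    induction j with
    | zero => exact ⟨0, by simp [Z]⟩
    | succ j ih =>
      obtain ⟨n, hn⟩ := ih
      obtain ⟨k, hk, hku⟩ := frequently_atTop.1 hfu (max n m)
      refine ⟨k + 1, ?_⟩
      simp only [Z, Finset.prod_range_succ]
      rw [pow_succ, hfac k, if_neg (by omega), if_pos hku]
      gcongr
      exact hn.trans (hmono (by omega : n ≤ k))
  refine tendsto_atTop_isLUB hmono ⟨fun _ _ => le_top, fun b hb => ?_⟩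
  have hlim : Tendsto (fun j : ℕ => (a : ℝ≥0∞) ^ j) atTop (nhds ∞) := by
    refine ENNReal.tendsto_pow_atTop_nhds_top_iff.2 ?_
    rw [← ENNReal.coe_one, ENNReal.coe_lt_coe, ha]
    exact lt_add_of_pos_right 1 hp
  refine le_of_tendsto' hlim fun j => ?_
  obtain ⟨n, hn⟩ := hgrow j
  exact hn.trans (hb ⟨n, rfl⟩)

end StochasticGame

/-! ### Mixtures of a pure and a uniform choice -/

namespace StochasticGame

variable {V : Type*} [Fintype V]

open Classical in
/-- The weight that the mixture of the pure choice `s` (with probability `1 - ε`) and the uniform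
choice among all successors (with probability `ε`) gives to the step from `v` to `w`. -/
noncomputable def mixedWeight (G : StochasticGame V) (s : V → V) (ε : ℝ≥0) (v w : V) : ℝ≥0 :=
  (1 - ε) * (if w = s v then 1 else 0) +
    ε * (if w ∈ G.post v then (((Finset.univ.filter (· ∈ G.post v)).card : ℝ≥0))⁻¹ else 0)

lemma card_post_pos (G : StochasticGame V) (v : V) [DecidablePred (· ∈ G.post v)] :
    0 < (Finset.univ.filter (· ∈ G.post v)).card := by
  obtain ⟨w, hw⟩ := G.post_nonempty v
  exact Finset.card_pos.2 ⟨w, Finset.mem_filter.2 ⟨Finset.mem_univ w, hw⟩⟩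

lemma sum_mixedWeight (G : StochasticGame V) (s : V → V) {ε : ℝ≥0} (hε : ε ≤ 1) (v : V) :
    ∑ w, G.mixedWeight s ε v w = 1 := by
  classical
  have hc : ((Finset.univ.filter (· ∈ G.post v)).card : ℝ≥0) ≠ 0 := by
    exact_mod_cast (G.card_post_pos v).ne'
  simp only [mixedWeight, Finset.sum_add_distrib, ← Finset.mul_sum]
  rw [← Finset.sum_filter, ← Finset.sum_filter, Finset.sum_const, Finset.sum_const]
  have h1 : (Finset.univ.filter (fun w => w = s v)).card = 1 :=
    Finset.card_eq_one.2 ⟨s v, by ext; simp⟩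
  rw [h1, one_smul, mul_one, nsmul_eq_mul, mul_inv_cancel₀ hc, mul_one]
  exact tsub_add_cancel_of_le hε

/-- The memoryless strategy with the weights `mixedWeight`. -/
noncomputable def mixedStrategy (G : StochasticGame V) (S : Set V) (s : V → V)
    (hs : ∀ v, s v ∈ G.post v) (ε : ℝ≥0) (hε : ε ≤ 1) : G.Strategy S where
  choice _ v := PMF.ofFintype (fun w => (G.mixedWeight s ε v w : ℝ≥0∞))
    (by exact_mod_cast G.sum_mixedWeight s hε v)
  choice_post _ v w hw := by
    by_contra hc
    have h1 : w ≠ s v := fun h => hc (h ▸ hs v)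
    simp [mixedWeight, h1, hc] at hw

lemma mixedStrategy_memoryless (G : StochasticGame V) (S : Set V) (s : V → V)
    (hs : ∀ v, s v ∈ G.post v) (ε : ℝ≥0) (hε : ε ≤ 1) :
    (G.mixedStrategy S s hs ε hε).Memoryless := fun _ _ => rfl

lemma mixedStrategy_apply (G : StochasticGame V) (S : Set V) (s : V → V)
    (hs : ∀ v, s v ∈ G.post v) (ε : ℝ≥0) (hε : ε ≤ 1) (h : List V) (v : S) (w : V) :
    (G.mixedStrategy S s hs ε hε).choice h v w = G.mixedWeight s ε v w := rfl

lemma mixedWeight_zero (G : StochasticGame V) (s : V → V) (v w : V) [Decidable (w = s v)] :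
    G.mixedWeight s 0 v w = if w = s v then 1 else 0 := by
  simp [mixedWeight]

variable [MeasurableSpace V] [MeasurableSingletonClass V]

/-- Whatever the history, each successor of a vertex of Player 2 gets at least `ε` divided by the
number of successors, so the recurrence lemma applies to each of the finitely many edges. -/
lemma mixedStrategy_fair (G : StochasticGame V) (s : V → V) (hs : ∀ v, s v ∈ G.post v)
    (ε : ℝ≥0) (hε : ε ≤ 1) (hε0 : 0 < ε) : G.Fair (G.mixedStrategy G.V₂ s hs ε hε) := by
  classical
  intro σ₁ v
  have h : ∀ᵐ ω ∂(G.pathMeasure σ₁ (G.mixedStrategy G.V₂ s hs ε hε) v), ω ∈ G.fairPlays := by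
    have h1 : ∀ u w, u ∈ G.V₂ ∧ w ∈ G.post u →
        ∀ᵐ ω ∂(G.pathMeasure σ₁ (G.mixedStrategy G.V₂ s hs ε hε) v),
          (∃ᶠ n in atTop, ω n = u) → ∃ᶠ n in atTop, ω n = w := by
      rintro u w ⟨hu, hw⟩
      have hc : 0 < ((Finset.univ.filter (· ∈ G.post u)).card : ℝ≥0) := by
        exact_mod_cast G.card_post_pos u
      refine G.ae_frequently_of_le_nextLaw _ _ v u w
        (ε * ((Finset.univ.filter (· ∈ G.post u)).card : ℝ≥0)⁻¹)
        (mul_pos hε0 (inv_pos.2 hc)) fun h => ?_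
      rw [G.nextLaw_player2 _ _ h hu, mixedStrategy_apply, ENNReal.coe_le_coe]
      simp [mixedWeight, hw]
    have h2 : ∀ᵐ ω ∂(G.pathMeasure σ₁ (G.mixedStrategy G.V₂ s hs ε hε) v),
        ∀ u w, u ∈ G.V₂ ∧ w ∈ G.post u →
          (∃ᶠ n in atTop, ω n = u) → ∃ᶠ n in atTop, ω n = w := by
      simp only [ae_all_iff]
      exact h1
    filter_upwards [h2, G.ae_mem_paths σ₁ _ v] with ω h2 hp
    exact ⟨hp, fun u hu hfu w hw => h2 u w ⟨hu, hw⟩ hfu⟩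
  exact (measure_congr (eventuallyEq_univ.2 h)).trans measure_univ

end StochasticGame

/-! ### Bellman inequalities and expected rewards -/

namespace RewardGame

open StochasticGame

variable {V : Type*} [Fintype V] [MeasurableSpace V] [MeasurableSingletonClass V]

lemma expectedReward_eq_tsum (G : RewardGame V) (σ₁ : G.Strategy G.V₁)
    (σ₂ : G.Strategy G.V₂) (v : V) :
    G.expectedReward σ₁ σ₂ v =
      ∑' n, ∫⁻ ω, (G.reward (ω n) : ℝ≥0∞) ∂(G.pathMeasure σ₁ σ₂ v) := by
  unfold expectedReward totalReward
  exact lintegral_tsum fun n => ((measurable_of_countable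
    (fun v : V => (G.reward v : ℝ≥0∞))).comp (measurable_pi_apply n)).aemeasurable

lemma lintegral_eval_zero (G : RewardGame V) (σ₁ : G.Strategy G.V₁)
    (σ₂ : G.Strategy G.V₂) (v : V) (h : V → ℝ≥0∞) :
    ∫⁻ ω, h (ω 0) ∂(G.pathMeasure σ₁ σ₂ v) = h v := by
  rw [lintegral_congr_ae (g := fun _ => h v)]
  · simp
  · filter_upwards [G.ae_eq_zero σ₁ σ₂ v] with ω hω
    rw [hω]

lemma lintegral_reward_add (G : RewardGame V) (σ₁ : G.Strategy G.V₁)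
    (σ₂ : G.Strategy G.V₂) (v : V) (h : V → ℝ≥0∞) (n : ℕ) :
    ∫⁻ ω, (G.reward (ω n) : ℝ≥0∞) ∂(G.pathMeasure σ₁ σ₂ v) +
      ∫⁻ ω, h (ω (n + 1)) ∂(G.pathMeasure σ₁ σ₂ v) =
    ∫⁻ ω, ((G.reward (ω n) : ℝ≥0∞) +
      ∑ w, h w * G.nextLaw σ₁ σ₂ (List.ofFn fun i : Fin n => ω i) (ω n) w)
        ∂(G.pathMeasure σ₁ σ₂ v) := by
  rw [G.lintegral_pathMeasure_succ σ₁ σ₂ v n (fun _ w => h w) (fun _ _ _ => rfl),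
    lintegral_add_left]
  exact (measurable_of_countable (fun v : V => (G.reward v : ℝ≥0∞))).comp (measurable_pi_apply n)

/-- A supersolution of the Bellman equation bounds the expected reward from above. -/
lemma expectedReward_le_of_supersolution (G : RewardGame V) (σ₁ : G.Strategy G.V₁)
    (σ₂ : G.Strategy G.V₂) (h : V → ℝ≥0∞)
    (hh : ∀ l u, (G.reward u : ℝ≥0∞) + ∑ w, h w * G.nextLaw σ₁ σ₂ l u w ≤ h u) (v : V) :
    G.expectedReward σ₁ σ₂ v ≤ h v := by
  rw [expectedReward_eq_tsum]
  have hsum : ∀ n, ∑ i ∈ Finset.range n,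
      ∫⁻ ω, (G.reward (ω i) : ℝ≥0∞) ∂(G.pathMeasure σ₁ σ₂ v) +
        ∫⁻ ω, h (ω n) ∂(G.pathMeasure σ₁ σ₂ v) ≤ h v := by
    intro n
    induction n with
    | zero => simp [G.lintegral_eval_zero]
    | succ n ih =>
      rw [Finset.sum_range_succ, add_assoc, G.lintegral_reward_add]
      refine le_trans ?_ ih
      gcongr with ω
      exact hh _ _
  exact ENNReal.tsum_le_of_sum_range_le fun n => le_self_add.trans (hsum n)

/-- A bounded subsolution of the Bellman equation that vanishes at terminal vertices bounds the
expected reward from below, if a terminal vertex is reached almost surely. -/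
lemma le_expectedReward_of_subsolution (G : RewardGame V) (σ₁ : G.Strategy G.V₁)
    (σ₂ : G.Strategy G.V₂) (h : V → ℝ≥0∞) (hfin : ∀ u, h u ≠ ∞)
    (hterm : ∀ u ∈ G.terminal, h u = 0)
    (hh : ∀ l u, h u ≤ (G.reward u : ℝ≥0∞) + ∑ w, h w * G.nextLaw σ₁ σ₂ l u w) (v : V)
    (hreach : G.pathMeasure σ₁ σ₂ v G.reachTerminal = 1) :
    h v ≤ G.expectedReward σ₁ σ₂ v := by
  have hsum : ∀ n, h v ≤ ∑ i ∈ Finset.range n,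
      ∫⁻ ω, (G.reward (ω i) : ℝ≥0∞) ∂(G.pathMeasure σ₁ σ₂ v) +
        ∫⁻ ω, h (ω n) ∂(G.pathMeasure σ₁ σ₂ v) := by
    intro n
    induction n with
    | zero => simp [G.lintegral_eval_zero]
    | succ n ih =>
      rw [Finset.sum_range_succ, add_assoc, G.lintegral_reward_add]
      refine ih.trans ?_
      gcongr with ω
      exact hh _ _
  have hae : ∀ᵐ ω ∂(G.pathMeasure σ₁ σ₂ v), ω ∈ G.reachTerminal :=
    (mem_ae_iff_prob_eq_one G.measurableSet_reachTerminal).2 hreach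
  -- Terminal vertices are absorbing, so `h (ω n)` is eventually zero almost surely; the finite sum
  -- of all values of `h` dominates.
  have hlim : Tendsto (fun n => ∫⁻ ω, h (ω n) ∂(G.pathMeasure σ₁ σ₂ v)) atTop (nhds 0) := by
    have := tendsto_lintegral_of_dominated_convergence (μ := G.pathMeasure σ₁ σ₂ v)
      (F := fun n ω => h (ω n)) (f := fun _ => 0) (fun _ => ∑ u, h u)
      (fun n => (measurable_of_countable h).comp (measurable_pi_apply n))
      (fun n => Eventually.of_forall fun ω =>
        Finset.single_le_sum (f := h) (fun _ _ => zero_le) (Finset.mem_univ (ω n)))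
      (by simpa using hfin) ?_
    · simpa using this
    · filter_upwards [hae] with ω hω
      obtain ⟨hp, i, hi⟩ := hω
      refine tendsto_const_nhds.congr' ?_
      filter_upwards [eventually_ge_atTop i] with n hn
      exact (hterm _ (G.mem_terminal_of_le hp hn hi)).symm
  rw [expectedReward_eq_tsum]
  have hlim2 := (ENNReal.summable.hasSum.tendsto_sum_nat (f := fun n =>
    ∫⁻ ω, (G.reward (ω n) : ℝ≥0∞) ∂(G.pathMeasure σ₁ σ₂ v))).add hlim
  rw [add_zero] at hlim2
  exact ge_of_tendsto' hlim2 hsum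

end RewardGame

/-! ### Traps, attractors and potentials -/

namespace StochasticGame

variable {V : Type*} [Fintype V]

/-- A set without terminal vertices in which Player 1 can keep the play when Player 2 moves
inside `S`. -/
structure IsTrap (G : StochasticGame V) (S : V → Set V) (X : Set V) : Prop where
  not_terminal : ∀ v ∈ X, v ∉ G.terminal
  player1 : ∀ v ∈ X, G.owner v = Owner.player1 → ∃ w ∈ G.post v, w ∈ X
  player2 : ∀ v ∈ X, G.owner v = Owner.player2 → ∀ w ∈ S v, w ∈ X
  chance : ∀ v ∈ X, G.owner v = Owner.chance → ∀ w ∈ G.post v, w ∈ X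

/-- The vertices from which Player 2, moving inside `S`, reaches a terminal vertex within `n`
steps with positive probability. -/
def attractor (G : StochasticGame V) (S : V → Set V) : ℕ → Set V
  | 0 => G.terminal
  | n + 1 => {v | v ∈ attractor G S n ∨
      (G.owner v = Owner.player1 ∧ ∀ w ∈ G.post v, w ∈ attractor G S n) ∨
      (G.owner v = Owner.player2 ∧ ∃ w ∈ S v, w ∈ attractor G S n) ∨
      (G.owner v = Owner.chance ∧ ∃ w ∈ G.post v, w ∈ attractor G S n)}

lemma attractor_mono (G : StochasticGame V) (S : V → Set V) : Monotone (G.attractor S) :=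
  monotone_nat_of_le_succ fun _ _ hv => Or.inl hv

lemma isTrap_compl_attractor (G : StochasticGame V) (S : V → Set V) :
    G.IsTrap S {v | ∀ n, v ∉ G.attractor S n} where
  not_terminal v hv := hv 0
  player1 v hv ho := by
    by_contra! hc
    have h1 : ∀ w : V, ∃ n, w ∈ G.post v → w ∈ G.attractor S n := by
      intro w
      by_cases hw : w ∈ G.post v
      · have : ¬ ∀ n, w ∉ G.attractor S n := hc w hw
        exact (not_forall_not.1 this).imp fun n hn _ => hn
      · exact ⟨0, fun h => absurd h hw⟩
    choose n hn using h1
    -- By finiteness one stage of the attractor contains all successors at once.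
    refine hv (Finset.univ.sup n + 1) (Or.inr (Or.inl ⟨ho, fun w hw => ?_⟩))
    exact G.attractor_mono S (Finset.le_sup (Finset.mem_univ w)) (hn w hw)
  player2 v hv ho w hw n hn := hv (n + 1) (Or.inr (Or.inr (Or.inl ⟨ho, w, hw, hn⟩)))
  chance v hv ho w hw n hn := hv (n + 1) (Or.inr (Or.inr (Or.inr ⟨ho, w, hw, hn⟩)))

/-- The rank is the first stage of the attractor that contains the vertex. Every vertex has one,
because the complement of the attractor is a trap. -/
lemma exists_rank (G : StochasticGame V) (S : V → Set V) (hS : ∀ X, G.IsTrap S X → X = ∅) :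
    ∃ ρ : V → ℕ, (∀ v ∈ G.terminal, ρ v = 0) ∧
      (∀ v ∉ G.terminal, G.owner v = Owner.player1 → ∀ w ∈ G.post v, ρ w < ρ v) ∧
      (∀ v ∉ G.terminal, G.owner v = Owner.player2 → ∃ w ∈ S v, ρ w < ρ v) ∧
      (∀ v ∉ G.terminal, G.owner v = Owner.chance → ∃ w ∈ G.post v, ρ w < ρ v) := by
  classical
  have hex : ∀ v, ∃ n, v ∈ G.attractor S n := by
    intro v
    by_contra! hc
    have := hS _ (G.isTrap_compl_attractor S)
    exact (this ▸ (show v ∈ {v | ∀ n, v ∉ G.attractor S n} from hc) : v ∈ (∅ : Set V))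
  have hkey : ∀ v ∉ G.terminal, ∃ k, Nat.find (hex v) = k + 1 ∧
      ((G.owner v = Owner.player1 ∧ ∀ w ∈ G.post v, w ∈ G.attractor S k) ∨
      (G.owner v = Owner.player2 ∧ ∃ w ∈ S v, w ∈ G.attractor S k) ∨
      (G.owner v = Owner.chance ∧ ∃ w ∈ G.post v, w ∈ G.attractor S k)) := by
    intro v hv
    rcases h : Nat.find (hex v) with _ | k
    · exact absurd ((Nat.find_eq_zero (hex v)).1 h) hv
    · have h1 := Nat.find_spec (hex v)
      rw [h] at h1
      rcases h1 with h1 | h1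
      · exact absurd h1 (Nat.find_min (hex v) (by omega))
      · exact ⟨k, rfl, h1⟩
  have hlt : ∀ {w k}, w ∈ G.attractor S k → Nat.find (hex w) < k + 1 := fun {w k} hw =>
    Nat.lt_succ_of_le (Nat.find_min' (hex w) hw)
  refine ⟨fun v => Nat.find (hex v), fun v hv => (Nat.find_eq_zero _).2 hv, ?_, ?_, ?_⟩
  · intro v hv ho w hw
    obtain ⟨k, hk, h | h | h⟩ := hkey v hv
    · simp only [hk]; exact hlt (h.2 w hw)
    · simp [ho] at h
    · simp [ho] at h
  · intro v hv ho
    obtain ⟨k, hk, h | h | h⟩ := hkey v hv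
    · simp [ho] at h
    · obtain ⟨w, hw, hw'⟩ := h.2
      exact ⟨w, hw, by simp only [hk]; exact hlt hw'⟩
    · simp [ho] at h
  · intro v hv ho
    obtain ⟨k, hk, h | h | h⟩ := hkey v hv
    · simp [ho] at h
    · simp [ho] at h
    · obtain ⟨w, hw, hw'⟩ := h.2
      exact ⟨w, hw, by simp only [hk]; exact hlt hw'⟩

lemma exists_pos_le_δ (G : StochasticGame V) :
    ∃ p : ℝ, 0 < p ∧ p ≤ 1 ∧ ∀ v w, w ∈ G.post v → p ≤ G.δ v w := by
  have h : ∀ᶠ p : ℝ in nhdsWithin 0 (Set.Ioi 0), ∀ v w, w ∈ G.post v → p ≤ G.δ v w := by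
    simp only [eventually_all]
    intro v w hw
    have hw' : (0 : ℝ) < G.δ v w := by exact_mod_cast (show 0 < G.δ v w from hw)
    exact eventually_nhdsWithin_of_eventually_nhds (eventually_le_nhds hw')
  obtain ⟨p, ⟨h1, h2⟩, h3⟩ := ((h.and (eventually_nhdsWithin_of_eventually_nhds
    (eventually_le_nhds one_pos))).and self_mem_nhdsWithin).exists
  exact ⟨p, h3, h2, h1⟩

lemma chance_sum_real (G : StochasticGame V) {v : V} (hv : G.owner v = Owner.chance) :
    ∑ w, (G.δ v w : ℝ) = 1 := by
  exact_mod_cast G.chance_sum v hv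

/-- If there is no trap, then there is a potential that decreases by one in each step, in
expectation, when Player 2 chooses well inside `S`. -/
lemma exists_potential (G : StochasticGame V) (S : V → Set V)
    (hS : ∀ X, G.IsTrap S X → X = ∅) :
    ∃ g : V → ℝ, (∀ v, 0 ≤ g v) ∧ (∀ v ∈ G.terminal, g v = 0) ∧
      (∀ v ∉ G.terminal, G.owner v = Owner.player1 → ∀ w ∈ G.post v, g w + 1 ≤ g v) ∧
      (∀ v ∉ G.terminal, G.owner v = Owner.player2 → ∃ w ∈ S v, g w + 1 ≤ g v) ∧
      (∀ v ∉ G.terminal, G.owner v = Owner.chance → ∑ w, G.δ v w * g w + 1 ≤ g v) := by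
  classical
  obtain ⟨ρ, hρ0, hρ1, hρ2, hρ3⟩ := G.exists_rank S hS
  obtain ⟨p, hp, hp1, hpδ⟩ := G.exists_pos_le_δ
  -- With `C (1 - x ^ ρ)` as potential, a chance of `p` to reach a smaller rank `k` contributes `p *
  -- x ^ k = 2 * x ^ (k + 1)`. One half offsets `x ^ ρ v`, the other is the gain, however large the
  -- other ranks are.
  set x : ℝ := p / 2 with hx
  have hx0 : 0 < x := by positivity
  have hx1 : x ≤ 1 := by linarith
  set N := Finset.univ.sup ρ with hN
  have hρN : ∀ v, ρ v ≤ N := fun v => Finset.le_sup (Finset.mem_univ v)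
  -- This scale makes the smallest possible gain, `C * x ^ N`, equal to one.
  set C : ℝ := (x ^ N)⁻¹ with hC
  have hC0 : 0 < C := by positivity
  have hCx : C * x ^ N = 1 := inv_mul_cancel₀ (by positivity)
  have hgap : ∀ k, k < N → 1 ≤ C * (x ^ k * x) := by
    intro k hk
    rw [← hCx, ← pow_succ]
    exact mul_le_mul_of_nonneg_left (pow_le_pow_of_le_one hx0.le hx1 hk) hC0.le
  have hstep : ∀ v w, ρ w < ρ v → C * (1 - x ^ ρ w) + 1 ≤ C * (1 - x ^ ρ v) := by
    intro v w h
    have h1 := hgap (ρ w) (h.trans_le (hρN v))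
    have h2 : x ^ ρ v ≤ x ^ ρ w * x := by
      rw [← pow_succ]; exact pow_le_pow_of_le_one hx0.le hx1 h
    have h3 : x ^ ρ w * x * 2 ≤ x ^ ρ w := by
      have : 0 < x ^ ρ w := by positivity
      nlinarith
    nlinarith
  refine ⟨fun v => C * (1 - x ^ ρ v), fun v => ?_, fun v hv => by simp [hρ0 v hv], ?_, ?_, ?_⟩
  · exact mul_nonneg hC0.le (sub_nonneg.2 (pow_le_one₀ hx0.le hx1))
  · exact fun v hv ho w hw => hstep v w (hρ1 v hv ho w hw)
  · intro v hv ho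
    obtain ⟨w, hw, h⟩ := hρ2 v hv ho
    exact ⟨w, hw, hstep v w h⟩
  · intro v hv ho
    obtain ⟨w, hw, h⟩ := hρ3 v hv ho
    have h1 := hgap (ρ w) (h.trans_le (hρN v))
    have h2 : x ^ ρ v ≤ x ^ ρ w * x := by
      rw [← pow_succ]; exact pow_le_pow_of_le_one hx0.le hx1 h
    have h3 : p * x ^ ρ w ≤ ∑ u, (G.δ v u : ℝ) * x ^ ρ u := by
      refine le_trans ?_ (Finset.single_le_sum (f := fun u => (G.δ v u : ℝ) * x ^ ρ u)
        (fun u _ => by positivity) (Finset.mem_univ w))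
      exact mul_le_mul_of_nonneg_right (hpδ v w hw) (by positivity)
    have h4 : ∑ u, (G.δ v u : ℝ) * (C * (1 - x ^ ρ u)) =
        C * (1 - ∑ u, (G.δ v u : ℝ) * x ^ ρ u) := by
      have : ∀ u, (G.δ v u : ℝ) * (C * (1 - x ^ ρ u)) =
          C * G.δ v u - C * (G.δ v u * x ^ ρ u) := fun u => by ring
      simp only [this, Finset.sum_sub_distrib, ← Finset.mul_sum, G.chance_sum_real ho]
      ring
    rw [h4]
    have h5 : p * x ^ ρ w = x ^ ρ w * x + x ^ ρ w * x := by rw [hx]; ring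
    nlinarith

variable [MeasurableSpace V] [MeasurableSingletonClass V]

/-- In a game that is stopping under fairness, Player 1 cannot avoid the terminal vertices. -/
lemma StoppingUnderFairness.isTrap_eq_empty {G : StochasticGame V} (hG : G.StoppingUnderFairness)
    {X : Set V} (hX : G.IsTrap G.post X) : X = ∅ := by
  classical
  by_contra hne
  obtain ⟨v, hv⟩ := Set.nonempty_iff_ne_empty.2 hne
  have h1 : ∀ u, ∃ w ∈ G.post u, u ∈ X → G.owner u = Owner.player1 → w ∈ X := by
    intro u
    by_cases hu : u ∈ X ∧ G.owner u = Owner.player1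
    · obtain ⟨w, hw, hwX⟩ := hX.player1 u hu.1 hu.2
      exact ⟨w, hw, fun _ _ => hwX⟩
    · obtain ⟨w, hw⟩ := G.post_nonempty u
      exact ⟨w, hw, fun a b => absurd ⟨a, b⟩ hu⟩
  choose s hs hsX using h1
  -- Player 1 stays in `X` by the pure choice `s` (`ε = 0`), against the uniform, hence fair,
  -- strategy (`ε = 1`).
  have hreach := hG (G.mixedStrategy G.V₁ s hs 0 zero_le_one) (G.mixedStrategy G.V₂ s hs 1 le_rfl)
    (G.mixedStrategy_fair s hs 1 le_rfl one_pos) v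
  have hae := (mem_ae_iff_prob_eq_one G.measurableSet_reachTerminal).2 hreach
  have hstay := G.ae_step (G.mixedStrategy G.V₁ s hs 0 zero_le_one)
    (G.mixedStrategy G.V₂ s hs 1 le_rfl) v (fun u w => u ∈ X → w ∈ X) (by
      intro h u w hw hu
      have hpost := G.mem_post_of_nextLaw_ne_zero _ _ h u w hw
      rcases ho : G.owner u
      · rw [G.nextLaw_player1 _ _ h ho, mixedStrategy_apply, mixedWeight_zero] at hw
        have : w = s u := by by_contra hc; simp [hc] at hw
        exact this ▸ hsX u hu ho
      · exact hX.player2 u hu ho w hpost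
      · exact hX.chance u hu ho w hpost)
  obtain ⟨ω, ⟨hr, hst⟩, h0⟩ := ((Eventually.and hae hstay).and (G.ae_eq_zero _ _ v)).exists
  have hall : ∀ n, ω n ∈ X := by
    intro n
    induction n with
    | zero => rwa [h0]
    | succ n ih => exact hst n ih
  obtain ⟨-, i, hi⟩ := hr
  exact hX.not_terminal _ (hall i) hi

end StochasticGame

/-! ### The greatest subsolution -/

namespace RewardGame

open StochasticGame

variable {V : Type*} [Fintype V]

/-- Real subsolutions of the Bellman equation. -/
structure IsSub (G : RewardGame V) (f : V → ℝ) : Prop where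
  terminal : ∀ v ∈ G.terminal, f v = 0
  player1 : ∀ v, G.owner v = Owner.player1 → ∃ w ∈ G.post v, f v ≤ G.reward v + f w
  player2 : ∀ v, G.owner v = Owner.player2 → ∀ w ∈ G.post v, f v ≤ G.reward v + f w
  chance : ∀ v, G.owner v = Owner.chance → f v ≤ G.reward v + ∑ w, G.δ v w * f w

lemma isSub_zero (G : RewardGame V) : G.IsSub fun _ => 0 where
  terminal _ _ := rfl
  player1 v _ := by
    obtain ⟨w, hw⟩ := G.post_nonempty v
    exact ⟨w, hw, by positivity⟩
  player2 v _ w _ := by positivity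
  chance v _ := by simp

/-- The subsolutions are bounded by any multiple of a potential that outweighs the rewards. -/
lemma IsSub.le_of_potential {G : RewardGame V} {f g : V → ℝ} {B : ℝ} (hf : G.IsSub f)
    (hB : ∀ v, (G.reward v : ℝ) < B) (hg0 : ∀ v ∈ G.terminal, g v = 0)
    (hg1 : ∀ v ∉ G.terminal, G.owner v = Owner.player1 → ∀ w ∈ G.post v, g w + 1 ≤ g v)
    (hg2 : ∀ v ∉ G.terminal, G.owner v = Owner.player2 → ∃ w ∈ G.post v, g w + 1 ≤ g v)
    (hg3 : ∀ v ∉ G.terminal, G.owner v = Owner.chance → ∑ w, G.δ v w * g w + 1 ≤ g v) (v : V) :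
    f v ≤ B * g v := by
  have : Nonempty V := ⟨v⟩
  -- Maximum principle: a positive maximum is nonterminal, and a step from it loses at least `B` in
  -- `B * g` while the reward offers less than `B`.
  obtain ⟨u, hu⟩ := Finite.exists_max fun v => f v - B * g v
  suffices h : f u - B * g u ≤ 0 by linarith [hu v]
  by_contra! hc
  have hut : u ∉ G.terminal := fun h => by simp [hf.terminal u h, hg0 u h] at hc
  have hB0 : 0 < B := (NNReal.coe_nonneg _).trans_lt (hB u)
  have hstep : ∀ w, g w + 1 ≤ g u → ¬ f u ≤ G.reward u + f w := by
    intro w hw h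
    nlinarith [hB u, hu w]
  rcases ho : G.owner u
  · obtain ⟨w, hw, h⟩ := hf.player1 u ho
    exact hstep w (hg1 u hut ho w hw) h
  · obtain ⟨w, hw, h⟩ := hg2 u hut ho
    exact hstep w h (hf.player2 u ho w hw)
  · have h1 := hf.chance u ho
    have h2 := hg3 u hut ho
    have h3 : ∑ w, (G.δ u w : ℝ) * f w ≤ ∑ w, (G.δ u w : ℝ) * (B * g w + (f u - B * g u)) :=
      Finset.sum_le_sum fun w _ => mul_le_mul_of_nonneg_left (by linarith [hu w]) (by positivity)
    have h4 : ∑ w, (G.δ u w : ℝ) * (B * g w + (f u - B * g u)) =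
        B * ∑ w, G.δ u w * g w + (f u - B * g u) := by
      simp only [mul_add, Finset.sum_add_distrib, ← Finset.sum_mul, G.chance_sum_real ho,
        Finset.mul_sum]
      rw [one_mul]
      congr 1
      exact Finset.sum_congr rfl fun w _ => by ring
    nlinarith [hB u]

/-- There is a greatest subsolution. -/
lemma exists_greatest_isSub (G : RewardGame V) (U : V → ℝ) (hU : ∀ f, G.IsSub f → ∀ v, f v ≤ U v) :
    ∃ F, G.IsSub F ∧ ∀ f, G.IsSub f → ∀ v, f v ≤ F v := by
  classical
  have : Nonempty {f // G.IsSub f} := ⟨⟨_, G.isSub_zero⟩⟩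
  have hle : ∀ f, G.IsSub f → ∀ v, f v ≤ ⨆ f : {f // G.IsSub f}, f.1 v := fun f hf v =>
    le_ciSup (f := fun f : {f // G.IsSub f} => f.1 v)
      ⟨U v, by rintro _ ⟨f, rfl⟩; exact hU f.1 f.2 v⟩ ⟨f, hf⟩
  refine ⟨fun v => ⨆ f : {f // G.IsSub f}, f.1 v, ⟨?_, ?_, ?_, ?_⟩, hle⟩
  · intro v hv
    simp [fun f : {f // G.IsSub f} => f.2.terminal v hv]
  · intro v hv
    -- The witness successor varies with the subsolution; a maximizer of the supremum serves them
    -- all.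
    obtain ⟨w, hw, hmax⟩ := Set.exists_max_image (G.post v)
      (fun w => ⨆ f : {f // G.IsSub f}, f.1 w) (Set.toFinite _) (G.post_nonempty v)
    refine ⟨w, hw, ciSup_le fun f => ?_⟩
    obtain ⟨u, hu, h⟩ := f.2.player1 v hv
    linarith [hle f.1 f.2 u, hmax u hu]
  · intro v hv w hw
    refine ciSup_le fun f => ?_
    linarith [f.2.player2 v hv w hw, hle f.1 f.2 w]
  · intro v hv
    refine ciSup_le fun f => (f.2.chance v hv).trans ?_
    gcongr with w
    exact hle f.1 f.2 w

/-- Raising a subsolution at one nonterminal vertex, compatibly with the Bellman equation there,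
gives a subsolution. -/
lemma IsSub.update {G : RewardGame V} [DecidableEq V] {f : V → ℝ} (hf : G.IsSub f) {v : V}
    (hv : v ∉ G.terminal) {c : ℝ} (hc : f v ≤ c)
    (h1 : G.owner v = Owner.player1 → ∃ w ∈ G.post v, c ≤ G.reward v + f w)
    (h2 : G.owner v = Owner.player2 → ∀ w ∈ G.post v, c ≤ G.reward v + f w)
    (h3 : G.owner v = Owner.chance → c ≤ G.reward v + ∑ w, G.δ v w * f w) :
    G.IsSub (Function.update f v c) := by
  have hle : ∀ w, f w ≤ Function.update f v c w := by
    intro w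
    by_cases h : w = v
    · subst h; simpa using hc
    · simp [h]
  have hsum : ∀ u, ∑ w, (G.δ u w : ℝ) * f w ≤ ∑ w, G.δ u w * Function.update f v c w := fun u =>
    Finset.sum_le_sum fun w _ => mul_le_mul_of_nonneg_left (hle w) (by positivity)
  refine ⟨fun u hu => ?_, fun u hu => ?_, fun u hu w hw => ?_, fun u hu => ?_⟩
  · rw [Function.update_of_ne (by rintro rfl; exact hv hu), hf.terminal u hu]
  all_goals by_cases huv : u = v
  · subst huv
    obtain ⟨w, hw, h⟩ := h1 hu
    exact ⟨w, hw, by rw [Function.update_self]; linarith [hle w]⟩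
  · obtain ⟨w, hw, h⟩ := hf.player1 u hu
    exact ⟨w, hw, by rw [Function.update_of_ne huv]; linarith [hle w]⟩
  · subst huv
    rw [Function.update_self]; linarith [hle w, h2 hu w hw]
  · rw [Function.update_of_ne huv]; linarith [hle w, hf.player2 u hu w hw]
  · subst huv
    rw [Function.update_self]; linarith [hsum u, h3 hu]
  · rw [Function.update_of_ne huv]; linarith [hsum u, hf.chance u hu]

section Greatest

variable {G : RewardGame V} {F : V → ℝ}

/-- Otherwise raising `F` at `v` would give a larger subsolution. This and the next two lemmas turn
`F` into a solution of Bellman's equation at nonterminal vertices. -/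
lemma le_of_greatest_player1 (hF : G.IsSub F) (hmax : ∀ f, G.IsSub f → ∀ v, f v ≤ F v) {v w : V}
    (hv : v ∉ G.terminal) (ho : G.owner v = Owner.player1) (hw : w ∈ G.post v) :
    G.reward v + F w ≤ F v := by
  classical
  by_contra! hc
  have := hmax _ (hF.update hv hc.le (fun _ => ⟨w, hw, le_rfl⟩) (by simp [ho]) (by simp [ho])) v
  rw [Function.update_self] at this
  linarith

lemma le_of_greatest_chance (hF : G.IsSub F) (hmax : ∀ f, G.IsSub f → ∀ v, f v ≤ F v) {v : V}
    (hv : v ∉ G.terminal) (ho : G.owner v = Owner.chance) :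
    G.reward v + ∑ w, G.δ v w * F w ≤ F v := by
  classical
  by_contra! hc
  have := hmax _ (hF.update hv hc.le (by simp [ho]) (by simp [ho]) (fun _ => le_rfl)) v
  rw [Function.update_self] at this
  linarith

lemma exists_le_of_greatest_player2 (hF : G.IsSub F) (hmax : ∀ f, G.IsSub f → ∀ v, f v ≤ F v)
    {v : V} (hv : v ∉ G.terminal) (ho : G.owner v = Owner.player2) :
    ∃ w ∈ G.post v, G.reward v + F w ≤ F v := by
  classical
  obtain ⟨w, hw, hmin⟩ := Set.exists_min_image (G.post v) F (Set.toFinite _) (G.post_nonempty v)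
  refine ⟨w, hw, ?_⟩
  by_contra! hc
  have := hmax _ (hF.update hv hc.le (by simp [ho]) (fun _ u hu => by linarith [hmin u hu])
    (by simp [ho])) v
  rw [Function.update_self] at this
  linarith

/-- Player 1 cannot avoid the terminal vertices when Player 2 uses the moves that are optimal
with respect to the greatest subsolution: otherwise that subsolution could be raised. -/
lemma isTrap_optimal_eq_empty (hF : G.IsSub F) (hmax : ∀ f, G.IsSub f → ∀ v, f v ≤ F v)
    {X : Set V} (hX : G.IsTrap (fun v => {w | w ∈ G.post v ∧ G.reward v + F w ≤ F v}) X) :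
    X = ∅ := by
  classical
  by_contra hne
  obtain ⟨m, hm, hmin⟩ := Set.exists_min_image X F (Set.toFinite _)
    (Set.nonempty_iff_ne_empty.2 hne)
  -- On this lowest level, nonnegative rewards and the reverse Bellman inequalities force chance
  -- moves, and Player 1's moves that stay in `X`, to remain in `C`.
  set C : Set V := {v | v ∈ X ∧ F v = F m} with hC
  have hr : ∀ v, 0 ≤ (G.reward v : ℝ) := fun v => NNReal.coe_nonneg _
  have hchance : ∀ v ∈ C, G.owner v = Owner.chance → ∀ w ∈ G.post v, w ∈ C := by
    intro v hv ho w hw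
    have hwX := hX.chance v hv.1 ho
    refine ⟨hwX w hw, ?_⟩
    have h1 := le_of_greatest_chance hF hmax (hX.not_terminal v hv.1) ho
    have h2 : ∀ u, 0 ≤ (G.δ v u : ℝ) * (F u - F m) := by
      intro u
      by_cases hu : u ∈ G.post v
      · exact mul_nonneg (NNReal.coe_nonneg _) (sub_nonneg.2 (hmin u (hwX u hu)))
      · have : G.δ v u = 0 := by
          by_contra h0
          exact hu (pos_iff_ne_zero.2 h0)
        simp [this]
    have h3 : ∑ u, (G.δ v u : ℝ) * (F u - F m) = ∑ u, (G.δ v u : ℝ) * F u - F m := by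
      simp only [mul_sub, Finset.sum_sub_distrib, ← Finset.sum_mul, G.chance_sum_real ho, one_mul]
    have h4 : (G.δ v w : ℝ) * (F w - F m) ≤ 0 := by
      have := Finset.single_le_sum (f := fun u => (G.δ v u : ℝ) * (F u - F m))
        (fun u _ => h2 u) (Finset.mem_univ w)
      rw [h3] at this
      linarith [hr v, hv.2]
    have h5 : (0 : ℝ) < G.δ v w := by exact_mod_cast (show 0 < G.δ v w from hw)
    have h6 := hmin w (hwX w hw)
    nlinarith
  have hplayer1 : ∀ v ∈ C, G.owner v = Owner.player1 → ∃ w ∈ G.post v, w ∈ C := by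
    intro v hv ho
    obtain ⟨w, hw, hwX⟩ := hX.player1 v hv.1 ho
    have h1 := le_of_greatest_player1 hF hmax (hX.not_terminal v hv.1) ho hw
    exact ⟨w, hw, hwX, by linarith [hr v, hv.2, hmin w hwX]⟩
  have hplayer2 : ∀ v ∈ C, G.owner v = Owner.player2 → ∀ w ∈ G.post v, w ∈ C ∨ F m < F w := by
    intro v hv ho w hw
    by_cases hopt : G.reward v + F w ≤ F v
    · have hwX := hX.player2 v hv.1 ho w ⟨hw, hopt⟩
      exact Or.inl ⟨hwX, by linarith [hr v, hv.2, hmin w hwX]⟩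
    -- An optimal move stays in `X`, where `F` is at least `F m`, so the reward at `v` is zero; a
    -- move that is not optimal must then lead strictly above `F m`.
    · obtain ⟨u, hu, h1⟩ := exists_le_of_greatest_player2 hF hmax (hX.not_terminal v hv.1) ho
      have h2 := hmin u (hX.player2 v hv.1 ho u ⟨hu, h1⟩)
      right
      linarith [hr v, hv.2]
  -- Raising `F` on `C` by at most the gap to the next higher value keeps the inequalities for moves
  -- that leave `C`.
  have hη : ∀ᶠ η : ℝ in nhdsWithin 0 (Set.Ioi 0), ∀ w, F m < F w → η ≤ F w - F m := by
    simp only [eventually_all]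
    intro w hw
    exact eventually_nhdsWithin_of_eventually_nhds (eventually_le_nhds (sub_pos.2 hw))
  obtain ⟨η, hη, hη0⟩ := (hη.and self_mem_nhdsWithin).exists
  have hη0 : 0 < η := hη0
  let f : V → ℝ := fun v => if v ∈ C then F v + η else F v
  have hle : ∀ v, F v ≤ f v := fun v => by simp only [f]; split_ifs <;> linarith
  have hin : ∀ {v}, v ∈ C → f v = F m + η := fun {v} hv => by simp [f, hv, hv.2]
  have hout : ∀ {v}, v ∉ C → f v = F v := fun {v} hv => by simp [f, hv]
  have hf : G.IsSub f := by
    refine ⟨fun v hv => ?_, fun v ho => ?_, fun v ho w hw => ?_, fun v ho => ?_⟩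
    · rw [hout fun h => hX.not_terminal v h.1 hv, hF.terminal v hv]
    all_goals by_cases hv : v ∈ C
    · obtain ⟨w, hw, hwC⟩ := hplayer1 v hv ho
      exact ⟨w, hw, by rw [hin hv, hin hwC]; linarith [hr v]⟩
    · obtain ⟨w, hw, h⟩ := hF.player1 v ho
      exact ⟨w, hw, by rw [hout hv]; linarith [hle w]⟩
    · rw [hin hv]
      rcases hplayer2 v hv ho w hw with h | h
      · rw [hin h]; linarith [hr v]
      · linarith [hη w h, hle w, hr v]
    · rw [hout hv]; linarith [hF.player2 v ho w hw, hle w]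
    · have : ∑ w, (G.δ v w : ℝ) * f w = F m + η := by
        rw [← one_mul (F m + η), ← G.chance_sum_real ho, Finset.sum_mul]
        refine Finset.sum_congr rfl fun w _ => ?_
        by_cases hw : w ∈ G.post v
        · rw [hin (hchance v hv ho w hw)]
        · have : G.δ v w = 0 := by
            by_contra h0
            exact hw (pos_iff_ne_zero.2 h0)
          simp [this]
      rw [hin hv, this]
      linarith [hr v]
    · rw [hout hv]
      have : ∑ w, (G.δ v w : ℝ) * F w ≤ ∑ w, G.δ v w * f w :=
        Finset.sum_le_sum fun w _ => mul_le_mul_of_nonneg_left (hle w) (by positivity)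
      linarith [hF.chance v ho]
  have h1 := hmax f hf m
  rw [hin ⟨hm, rfl⟩] at h1
  linarith

end Greatest

end RewardGame

/-! ### Averages in extended nonnegative reals -/

lemma PMF.add_sum_mul_le {V : Type*} [Fintype V] (p : PMF V) (h : V → ℝ≥0∞) {r A : ℝ≥0∞}
    (hA : ∀ w, p w ≠ 0 → r + h w ≤ A) : r + ∑ w, h w * p w ≤ A := by
  have h1 : ∑ w, p w = 1 := by
    rw [← tsum_fintype (L := .unconditional V)]; exact PMF.tsum_coe _
  calc r + ∑ w, h w * p w = ∑ w, (r + h w) * p w := by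
        simp only [add_mul, Finset.sum_add_distrib, ← Finset.mul_sum, h1, mul_one]
    _ ≤ ∑ w, A * p w := by
        refine Finset.sum_le_sum fun w _ => ?_
        by_cases hw : p w = 0
        · simp [hw]
        · gcongr; exact hA w hw
    _ = A := by rw [← Finset.mul_sum, h1, mul_one]

lemma PMF.le_add_sum_mul {V : Type*} [Fintype V] (p : PMF V) (h : V → ℝ≥0∞) {r A : ℝ≥0∞}
    (hA : ∀ w, p w ≠ 0 → A ≤ r + h w) : A ≤ r + ∑ w, h w * p w := by
  have h1 : ∑ w, p w = 1 := by
    rw [← tsum_fintype (L := .unconditional V)]; exact PMF.tsum_coe _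
  calc A = ∑ w, A * p w := by rw [← Finset.mul_sum, h1, mul_one]
    _ ≤ ∑ w, (r + h w) * p w := by
        refine Finset.sum_le_sum fun w _ => ?_
        by_cases hw : p w = 0
        · simp [hw]
        · gcongr; exact hA w hw
    _ = r + ∑ w, h w * p w := by
        simp only [add_mul, Finset.sum_add_distrib, ← Finset.mul_sum, h1, mul_one]

lemma ENNReal.coe_add_ofReal {r : ℝ≥0} {x : ℝ} (hx : 0 ≤ x) :
    (r : ℝ≥0∞) + ENNReal.ofReal x = ENNReal.ofReal (r + x) := by
  rw [ENNReal.ofReal_add r.coe_nonneg hx, ENNReal.ofReal_coe_nnreal]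

lemma ENNReal.coe_add_sum_ofReal_mul {V : Type*} [Fintype V] {r : ℝ≥0} {h : V → ℝ}
    (hh : ∀ w, 0 ≤ h w) (k : V → ℝ≥0) :
    (r : ℝ≥0∞) + ∑ w, ENNReal.ofReal (h w) * k w = ENNReal.ofReal (r + ∑ w, k w * h w) := by
  rw [← ENNReal.coe_add_ofReal (Finset.sum_nonneg fun w _ => mul_nonneg (k w).coe_nonneg (hh w)),
    ENNReal.ofReal_sum_of_nonneg fun w _ => mul_nonneg (k w).coe_nonneg (hh w)]
  congr 1
  refine Finset.sum_congr rfl fun w _ => ?_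
  rw [ENNReal.ofReal_mul (k w).coe_nonneg, ENNReal.ofReal_coe_nnreal, mul_comm]

namespace StochasticGame

variable {V : Type*} [Fintype V]

/-- The uniform part is `mixedWeight` with `ε = 1`, and its average is at most `H`. -/
lemma sum_mixedWeight_mul_le (G : StochasticGame V) (s : V → V) {ε : ℝ≥0} (hε : ε ≤ 1) (v : V)
    {h : V → ℝ} {H : ℝ} (hH : ∀ w, h w ≤ H) :
    ∑ w, (G.mixedWeight s ε v w : ℝ) * h w ≤ (1 - ε) * h (s v) + ε * H := by
  classical
  have h1 : ∑ w, (G.mixedWeight s 1 v w : ℝ) = 1 := by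
    exact_mod_cast G.sum_mixedWeight s le_rfl v
  have h2 : ∀ w, (G.mixedWeight s ε v w : ℝ) =
      (1 - ε) * (if w = s v then 1 else 0) + ε * G.mixedWeight s 1 v w := by
    intro w
    have h3 : G.mixedWeight s ε v w =
        (1 - ε) * (if w = s v then 1 else 0) + ε * G.mixedWeight s 1 v w := by
      simp [mixedWeight]
    rw [h3]
    split_ifs <;> simp [NNReal.coe_sub hε]
  calc ∑ w, (G.mixedWeight s ε v w : ℝ) * h w
      = (1 - ε) * h (s v) + ε * ∑ w, G.mixedWeight s 1 v w * h w := by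
        simp only [h2, add_mul, Finset.sum_add_distrib, Finset.mul_sum, mul_assoc]
        simp
    _ ≤ (1 - ε) * h (s v) + ε * ∑ w, G.mixedWeight s 1 v w * H := by
        gcongr with w
        exact hH w
    _ = _ := by rw [← Finset.sum_mul, h1, one_mul]

end StochasticGame

/-! ### Near-optimal memoryless strategies -/

namespace RewardGame

open StochasticGame

variable {V : Type*} [Fintype V] [MeasurableSpace V] [MeasurableSingletonClass V]

/-- In a game that is stopping under fairness, there is a greatest subsolution of the Bellman
equation. -/
lemma exists_greatest_isSub_of_stopping (G : RewardGame V) (hG : G.StoppingUnderFairness) :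
    ∃ F, G.IsSub F ∧ ∀ f, G.IsSub f → ∀ v, f v ≤ F v := by
  obtain ⟨g, -, hg0, hg1, hg2, hg3⟩ := G.exists_potential G.post fun X hX => hG.isTrap_eq_empty hX
  refine G.exists_greatest_isSub _ fun f hf v => hf.le_of_potential
    (B := ∑ v, (G.reward v : ℝ) + 1) (fun v => ?_) hg0 hg1 hg2 hg3 v
  have := Finset.single_le_sum (f := fun v => (G.reward v : ℝ)) (fun _ _ => NNReal.coe_nonneg _)
    (Finset.mem_univ v)
  linarith

section Greatest

variable {G : RewardGame V} {F : V → ℝ}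

/-- By moving greedily, Player 1 secures the values of a nonnegative subsolution against all fair
strategies. -/
lemma exists_memoryless_forall_le (hG : G.StoppingUnderFairness) (hF : G.IsSub F)
    (hF0 : ∀ v, 0 ≤ F v) :
    ∃ σ₁ : G.Strategy G.V₁, σ₁.Memoryless ∧ ∀ σ₂ : G.Strategy G.V₂, G.Fair σ₂ → ∀ v,
      ENNReal.ofReal (F v) ≤ G.expectedReward σ₁ σ₂ v := by
  classical
  have h1 : ∀ u, ∃ w ∈ G.post u, G.owner u = Owner.player1 → F u ≤ G.reward u + F w := by
    intro u
    by_cases hu : G.owner u = Owner.player1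
    · obtain ⟨w, hw, h⟩ := hF.player1 u hu
      exact ⟨w, hw, fun _ => h⟩
    · obtain ⟨w, hw⟩ := G.post_nonempty u
      exact ⟨w, hw, fun h => absurd h hu⟩
  choose s hs hsF using h1
  refine ⟨G.mixedStrategy G.V₁ s hs 0 zero_le_one, G.mixedStrategy_memoryless _ _ _ _ _,
    fun σ₂ hσ₂ v => ?_⟩
  -- Fairness of `σ₂` enters only through almost sure termination.
  refine G.le_expectedReward_of_subsolution _ σ₂ (fun u => ENNReal.ofReal (F u))
    (fun u => ENNReal.ofReal_ne_top) (fun u hu => by simp [hF.terminal u hu]) (fun l u => ?_) v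
    (hG _ σ₂ hσ₂ v)
  rcases ho : G.owner u
  · refine PMF.le_add_sum_mul _ _ fun w hw => ?_
    rw [G.nextLaw_player1 _ _ l ho, mixedStrategy_apply, mixedWeight_zero] at hw
    have : w = s u := by by_contra hc; simp [hc] at hw
    rw [ENNReal.coe_add_ofReal (hF0 w), this]
    exact ENNReal.ofReal_le_ofReal (hsF u ho)
  · refine PMF.le_add_sum_mul _ _ fun w hw => ?_
    rw [ENNReal.coe_add_ofReal (hF0 w)]
    exact ENNReal.ofReal_le_ofReal
      (hF.player2 u ho w (G.mem_post_of_nextLaw_ne_zero _ _ l u w hw))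
  · simp only [G.nextLaw_chance _ _ l ho]
    rw [ENNReal.coe_add_sum_ofReal_mul hF0]
    exact ENNReal.ofReal_le_ofReal (hF.chance u ho)

/-- By moving optimally most of the time and uniformly otherwise, Player 2 keeps the expected
reward arbitrarily close to the greatest subsolution. -/
lemma exists_memoryless_fair_forall_le (hF : G.IsSub F)
    (hmax : ∀ f, G.IsSub f → ∀ v, f v ≤ F v) :
    ∃ g : V → ℝ, ∀ η : ℝ, 0 < η → η ≤ 1 →
      ∃ σ₂ : G.Strategy G.V₂, (σ₂.Memoryless ∧ G.Fair σ₂) ∧ ∀ (σ₁ : G.Strategy G.V₁) (v : V),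
        G.expectedReward σ₁ σ₂ v ≤ ENNReal.ofReal (F v + η * g v) := by
  -- Restricting to optimal moves yields, at each nonterminal vertex of Player 2, one move that is
  -- both optimal for `F` and decreasing for `g`.
  obtain ⟨g, hg, hg0, hg1, hg2, hg3⟩ := G.exists_potential
    (fun v => {w | w ∈ G.post v ∧ G.reward v + F w ≤ F v})
    fun X hX => isTrap_optimal_eq_empty hF hmax hX
  have hF0 : ∀ v, 0 ≤ F v := hmax _ G.isSub_zero
  refine ⟨g, fun η hη hη1 => ?_⟩
  have h1 : ∀ u, ∃ w ∈ G.post u, u ∉ G.terminal → G.owner u = Owner.player2 →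
      G.reward u + F w ≤ F u ∧ g w + 1 ≤ g u := by
    intro u
    by_cases hu : u ∉ G.terminal ∧ G.owner u = Owner.player2
    · obtain ⟨w, hw, h⟩ := hg2 u hu.1 hu.2
      exact ⟨w, hw.1, fun _ _ => ⟨hw.2, h⟩⟩
    · obtain ⟨w, hw⟩ := G.post_nonempty u
      exact ⟨w, hw, fun a b => absurd ⟨a, b⟩ hu⟩
  choose s hs hsF using h1
  set H : ℝ := 1 + ∑ w, (F w + g w) with hH
  have hHle : ∀ w, F w + η * g w ≤ H := by
    intro w
    have := Finset.single_le_sum (f := fun w => F w + g w)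
      (fun w _ => add_nonneg (hF0 w) (hg w)) (Finset.mem_univ w)
    nlinarith [hg w]
  have hH1 : 1 ≤ H := le_add_of_nonneg_right
    (Finset.sum_nonneg fun w _ => add_nonneg (hF0 w) (hg w))
  have hH0 : 0 < H := by linarith
  -- A uniform move costs at most `H`, so mixing costs at most `ε * H = η`, exactly the slack of `F
  -- + η * g`.
  set ε : ℝ≥0 := ⟨η / H, by positivity⟩ with hε
  have hε0 : 0 < ε := show 0 < η / H by positivity
  have hε1 : ε ≤ 1 := show η / H ≤ 1 from (div_le_one hH0).2 (hη1.trans hH1)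
  have hεH : (ε : ℝ) * H = η := div_mul_cancel₀ _ hH0.ne'
  have hpos : ∀ w, 0 ≤ F w + η * g w := fun w =>
    add_nonneg (hF0 w) (mul_nonneg hη.le (hg w))
  refine ⟨G.mixedStrategy G.V₂ s hs ε hε1, ⟨G.mixedStrategy_memoryless _ _ _ _ _,
    G.mixedStrategy_fair s hs ε hε1 hε0⟩, fun σ₁ v => ?_⟩
  refine G.expectedReward_le_of_supersolution σ₁ _
    (fun w => ENNReal.ofReal (F w + η * g w)) (fun l u => ?_) v
  -- The potential does not decrease here, but the play stays put without reward.
  by_cases hu : u ∈ G.terminal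
  · refine PMF.add_sum_mul_le _ _ fun w hw => ?_
    rw [G.eq_of_mem_terminal_of_mem_post hu (G.mem_post_of_nextLaw_ne_zero _ _ l u w hw),
      G.reward_terminal u hu]
    simp
  rcases ho : G.owner u
  · refine PMF.add_sum_mul_le _ _ fun w hw => ?_
    have hw' := G.mem_post_of_nextLaw_ne_zero _ _ l u w hw
    rw [ENNReal.coe_add_ofReal (hpos w)]
    refine ENNReal.ofReal_le_ofReal ?_
    have h2 := le_of_greatest_player1 hF hmax hu ho hw'
    have h3 := hg1 u hu ho w hw'
    nlinarith
  · simp only [G.nextLaw_player2 _ _ l (show u ∈ G.V₂ from ho), mixedStrategy_apply]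
    rw [ENNReal.coe_add_sum_ofReal_mul hpos]
    refine ENNReal.ofReal_le_ofReal ?_
    obtain ⟨h2, h3⟩ := hsF u hu ho
    have h4 := G.sum_mixedWeight_mul_le s hε1 u hHle
    rw [hεH] at h4
    have h5 : 0 ≤ (ε : ℝ) * (F (s u) + η * g (s u)) := mul_nonneg ε.coe_nonneg (hpos _)
    nlinarith
  · simp only [G.nextLaw_chance _ _ l ho]
    rw [ENNReal.coe_add_sum_ofReal_mul hpos]
    refine ENNReal.ofReal_le_ofReal ?_
    have h2 := le_of_greatest_chance hF hmax hu ho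
    have h3 := hg3 u hu ho
    have h4 : ∑ w, (G.δ u w : ℝ) * (F w + η * g w) =
        ∑ w, (G.δ u w : ℝ) * F w + η * ∑ w, (G.δ u w : ℝ) * g w := by
      rw [Finset.mul_sum, ← Finset.sum_add_distrib]
      exact Finset.sum_congr rfl fun w _ => by ring
    rw [h4]
    nlinarith

end Greatest

end RewardGame

/-! ### Both values equal the greatest subsolution -/

theorem mainTheorem6 {V : Type*} [Fintype V] [MeasurableSpace V] [MeasurableSingletonClass V]
    (G : RewardGame V) (hG : G.StoppingUnderFairness) (v : V) :
    (⨆ σ₁ : G.Strategy G.V₁, ⨅ σ₂ : {σ : G.Strategy G.V₂ // G.Fair σ},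
        G.expectedReward σ₁ σ₂ v) =
      ⨆ σ₁ : {σ : G.Strategy G.V₁ // σ.Memoryless},
        ⨅ σ₂ : {σ : G.Strategy G.V₂ // σ.Memoryless ∧ G.Fair σ},
          G.expectedReward σ₁ σ₂ v := by
  obtain ⟨F, hF, hmax⟩ := G.exists_greatest_isSub_of_stopping hG
  obtain ⟨σ₁, hσ₁, hlow⟩ := RewardGame.exists_memoryless_forall_le hG hF (hmax _ G.isSub_zero)
  obtain ⟨g, hg⟩ := RewardGame.exists_memoryless_fair_forall_le hF hmax
  have hup : ∀ I : ℝ≥0∞, (∀ η : ℝ, 0 < η → η ≤ 1 → I ≤ ENNReal.ofReal (F v + η * g v)) →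
      I ≤ ENNReal.ofReal (F v) := by
    intro I hI
    have hlim : Tendsto (fun η : ℝ => ENNReal.ofReal (F v + η * g v))
        (nhdsWithin 0 (Set.Ioi 0)) (nhds (ENNReal.ofReal (F v))) := by
      have : Continuous fun η : ℝ => ENNReal.ofReal (F v + η * g v) :=
        ENNReal.continuous_ofReal.comp (by fun_prop)
      simpa using (this.tendsto 0).mono_left nhdsWithin_le_nhds
    refine ge_of_tendsto hlim ?_
    filter_upwards [self_mem_nhdsWithin,
      eventually_nhdsWithin_of_eventually_nhds (eventually_le_nhds one_pos)] with η h0 h1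
    exact hI η h0 h1
  trans ENNReal.ofReal (F v)
  · refine le_antisymm (iSup_le fun τ₁ => hup _ fun η h0 h1 => ?_)
      (le_iSup_of_le σ₁ (le_iInf fun τ₂ => hlow τ₂ τ₂.2 v))
    obtain ⟨σ₂, hσ₂, h⟩ := hg η h0 h1
    exact iInf_le_of_le ⟨σ₂, hσ₂.2⟩ (h τ₁ v)
  · refine le_antisymm (le_iSup_of_le ⟨σ₁, hσ₁⟩ (le_iInf fun τ₂ => hlow τ₂ τ₂.2.2 v))
      (iSup_le fun τ₁ => hup _ fun η h0 h1 => ?_)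
    obtain ⟨σ₂, hσ₂, h⟩ := hg η h0 h1
    exact iInf_le_of_le ⟨σ₂, hσ₂⟩ (h τ₁ v)
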